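/- Let $J:\mathbb{R}\to[0,\infty)$ be a $C^2$ function with derivative $j=J'$ such that (H1) $J(0)=0$ and $J(t)>0$ for all $t\in(0,\infty)$; (H2) $\displaystyle\liminf_{t\to-\infty}\frac{J(t)}{\sqrt{|t|}}>K$ for some $K>0$ (the value $+\infty$ of the lower limit being allowed); (H3$^-$) $j(t)<0$ for all $t\in(-\infty,0)$. Let $u:\mathbb{R}^2\to\mathbb{R}^2$ be a classical solution of $$-\Delta u=u\,j(1-|u|^2)\quad\text{in }\mathbb{R}^2,$$ that is, $u\in C^2(\mathbb{R}^2;\mathbb{R}^2)$ and the equation holds at every point. If $$\int_{\mathbb{R}^2}|\nabla u|^2\,dx<\infty\qquad\text{or}\qquad\int_{\mathbb{R}^2}J(1-|u|^2)\,dx<\infty,$$ then $|u(x)|\le 1$ for all $x\in\mathbb{R}^2$. -/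

import Mathlib

open scoped Real Topology ENNReal

/-- The Euclidean plane. -/
abbrev Plane : Type := EuclideanSpace ℝ (Fin 2)

/-- The squared Euclidean (Frobenius) norm `|∇u|² = ∑ᵢ |∂ᵢu|² = ∑ᵢⱼ (∂ᵢuⱼ)²` of the gradient. -/
noncomputable def gradSq (u : Plane → Plane) (x : Plane) : ℝ :=
  ∑ i : Fin 2, ‖fderiv ℝ u x (EuclideanSpace.single i 1)‖ ^ 2

/-- `u` is a classical solution of `-Δu = u j(1 - |u|²)` on the plane, where `j = J'`:
it is twice continuously differentiable and satisfies the equation at every point. -/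
def IsClassicalSolution (J : ℝ → ℝ) (u : Plane → Plane) : Prop :=
  ContDiff ℝ 2 u ∧ ∀ x : Plane, -(Laplacian.laplacian u x) = deriv J (1 - ‖u x‖ ^ 2) • u x

/-! Where `|u|² > 1`, `j(1 - |u|²) < 0`, so `u · Δu > 0`. Hence `p = √(1 + |u|²)`, smooth even at
zeros of `u`, has `Δp > 0` there (`inner_coordLaplacian_le`). If `|u|² > 1 + ε` somewhere, put `v =
ramp (p - √(2 + ε))`: convexity and monotonicity of the ramp make `v` subharmonic on the whole
plane, with `Δv > 0` at that point. A Liouville argument forces `Δv = 0`, a contradiction. Finite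
gradient energy gives `∇v ∈ L²`, because `|∇v| ≤ |∇p| ≤ |∇u|`; finite potential energy gives `v ∈
L¹`, because `v ≤ p ≤ C J(1 - |u|²)` where `v ≠ 0` (`exists_sqrt_le_mul`). -/

open MeasureTheory Filter

/-! ### Partial derivatives and integration by parts -/

section Calculus

variable {E : Type*} [NormedAddCommGroup E] [NormedSpace ℝ E]

/-- The `i`-th partial derivative of a function on the plane. -/
noncomputable def partialDeriv (i : Fin 2) (f : Plane → E) (x : Plane) : E :=
  fderiv ℝ f x (EuclideanSpace.single i 1)

/-- The sum of the pure second partial derivatives. -/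
noncomputable def coordLaplacian (f : Plane → E) (x : Plane) : E :=
  ∑ i : Fin 2, partialDeriv i (partialDeriv i f) x

theorem ContDiff.partialDeriv_succ {n : ℕ} {f : Plane → E} (hf : ContDiff ℝ (n + 1) f)
    (i : Fin 2) : ContDiff ℝ n (partialDeriv i f) :=
  (hf.fderiv_right le_rfl).clm_apply contDiff_const

theorem ContDiff.partialDeriv_one {f : Plane → E} (hf : ContDiff ℝ 2 f) (i : Fin 2) :
    ContDiff ℝ 1 (partialDeriv i f) := by
  have := ContDiff.partialDeriv_succ (n := 1) (f := f) (by norm_num; exact hf) i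
  exact_mod_cast this

theorem ContDiff.continuous_partialDeriv {f : Plane → E} (hf : ContDiff ℝ 1 f) (i : Fin 2) :
    Continuous (partialDeriv i f) :=
  (hf.continuous_fderiv one_ne_zero).clm_apply continuous_const

theorem ContDiff.continuous_coordLaplacian {f : Plane → E} (hf : ContDiff ℝ 2 f) :
    Continuous (coordLaplacian f) :=
  continuous_finsetSum _ fun i _ => (hf.partialDeriv_one i).continuous_partialDeriv i

theorem HasCompactSupport.partialDeriv {f : Plane → E} (hf : HasCompactSupport f) (i : Fin 2) :
    HasCompactSupport (partialDeriv i f) :=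
  hf.fderiv_apply ℝ _

theorem partialDeriv_comp_smul (i : Fin 2) (f : Plane → E) (c : ℝ) :
    partialDeriv i (fun x => f (c • x)) = fun x => c • partialDeriv i f (c • x) := by
  ext x
  simp [partialDeriv, fderiv_comp_smul]

theorem partialDeriv_const_smul (i : Fin 2) (f : Plane → E) (c : ℝ) :
    partialDeriv i (fun x => c • f x) = fun x => c • partialDeriv i f x := by
  ext x
  simp only [partialDeriv]
  rw [show (fun x => c • f x) = c • f from rfl, fderiv_const_smul_field]
  rfl

theorem laplacian_eq_coordLaplacian {f : Plane → E} (hf : ContDiff ℝ 2 f) (x : Plane) :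
    Laplacian.laplacian f x = coordLaplacian f x := by
  rw [InnerProductSpace.laplacian_eq_iteratedFDeriv_orthonormalBasis f
    (EuclideanSpace.basisFun (Fin 2) ℝ)]
  simp only [coordLaplacian, iteratedFDeriv_two_apply]
  refine Finset.sum_congr rfl fun i _ => ?_
  have h : DifferentiableAt ℝ (fderiv ℝ f) x :=
    ((hf.fderiv_right (m := 1) (by norm_num)).differentiable one_ne_zero) x
  have h2 : partialDeriv i f = fun y => fderiv ℝ f y (EuclideanSpace.single i 1) := rfl
  rw [h2, partialDeriv, fderiv_clm_apply h (differentiableAt_const _)]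
  simp

theorem integral_mul_partialDeriv {f g : Plane → ℝ} (hf : ContDiff ℝ 1 f) (hg : ContDiff ℝ 1 g)
    (hc : HasCompactSupport f) (i : Fin 2) :
    ∫ x, f x * partialDeriv i g x = -∫ x, partialDeriv i f x * g x := by
  refine integral_mul_fderiv_eq_neg_fderiv_mul_of_integrable ?_ ?_ ?_
    (fun x _ => hf.differentiable one_ne_zero x) (fun x _ => hg.differentiable one_ne_zero x)
  · exact ((hf.continuous_partialDeriv i).mul hg.continuous).integrable_of_hasCompactSupport
      (hc.partialDeriv i).mul_right
  · exact (hf.continuous.mul (hg.continuous_partialDeriv i)).integrable_of_hasCompactSupport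
      hc.mul_right
  · exact (hf.continuous.mul hg.continuous).integrable_of_hasCompactSupport hc.mul_right

theorem integral_mul_coordLaplacian {f g : Plane → ℝ} (hf : ContDiff ℝ 1 f)
    (hg : ContDiff ℝ 2 g) (hc : HasCompactSupport f) :
    ∫ x, f x * coordLaplacian g x =
      ∑ i : Fin 2, -∫ x, partialDeriv i f x * partialDeriv i g x := by
  simp only [coordLaplacian, Finset.mul_sum]
  rw [integral_finsetSum]
  · exact Finset.sum_congr rfl fun i _ =>
      integral_mul_partialDeriv hf (hg.partialDeriv_one i) hc i
  · intro i _
    exact (hf.continuous.mul ((hg.partialDeriv_one i).continuous_partialDeriv i)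
      ).integrable_of_hasCompactSupport hc.mul_right

theorem integral_mul_coordLaplacian_eq {f g : Plane → ℝ} (hf : ContDiff ℝ 2 f)
    (hg : ContDiff ℝ 2 g) (hc : HasCompactSupport f) :
    ∫ x, f x * coordLaplacian g x = ∫ x, coordLaplacian f x * g x := by
  rw [integral_mul_coordLaplacian (hf.of_le one_le_two) hg hc]
  simp only [coordLaplacian, Finset.sum_mul]
  rw [integral_finsetSum]
  · refine Finset.sum_congr rfl fun i _ => ?_
    rw [integral_mul_partialDeriv (hf.partialDeriv_one i) (hg.of_le one_le_two)
      (hc.partialDeriv i), neg_neg]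
  · intro i _
    exact (((hf.partialDeriv_one i).continuous_partialDeriv i).mul hg.continuous
      ).integrable_of_hasCompactSupport ((hc.partialDeriv i).partialDeriv i).mul_right

end Calculus

/-! ### Cutoffs and Liouville theorems for subharmonic functions -/

section Liouville

/-- A smooth bump equal to `1` on the unit ball and supported in the ball of radius `2`. -/
noncomputable def planeBump : ContDiffBump (0 : Plane) := ⟨1, 2, one_pos, one_lt_two⟩

/-- The bump `planeBump` dilated by the factor `R`. -/
noncomputable def cutoff (R : ℝ) (x : Plane) : ℝ := planeBump (R⁻¹ • x)

theorem contDiff_cutoff (R : ℝ) : ContDiff ℝ 2 (cutoff R) :=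
  planeBump.contDiff.comp (contDiff_const_smul _)

theorem cutoff_nonneg (R : ℝ) (x : Plane) : 0 ≤ cutoff R x := planeBump.nonneg

theorem cutoff_le_one (R : ℝ) (x : Plane) : cutoff R x ≤ 1 := planeBump.le_one

theorem cutoff_eq_one {R : ℝ} (hR : 0 < R) {x : Plane} (hx : ‖x‖ ≤ R) : cutoff R x = 1 := by
  refine planeBump.one_of_mem_closedBall ?_
  rw [mem_closedBall_zero_iff, norm_smul, norm_inv, Real.norm_of_nonneg hR.le]
  change R⁻¹ * ‖x‖ ≤ 1
  rwa [inv_mul_le_iff₀ hR, mul_one]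

theorem cutoff_eq_zero {R : ℝ} (hR : 0 < R) {x : Plane} (hx : 2 * R ≤ ‖x‖) : cutoff R x = 0 := by
  refine planeBump.zero_of_le_dist ?_
  rw [dist_zero_right, norm_smul, norm_inv, Real.norm_of_nonneg hR.le]
  change 2 ≤ R⁻¹ * ‖x‖
  rwa [le_inv_mul_iff₀ hR, mul_comm]

theorem hasCompactSupport_cutoff {R : ℝ} (hR : 0 < R) : HasCompactSupport (cutoff R) :=
  planeBump.hasCompactSupport.comp_smul (inv_ne_zero hR.ne')

theorem cutoff_le_cutoff {r R : ℝ} (hr : 0 < r) (hR : 2 * r ≤ R) (x : Plane) :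
    cutoff r x ≤ cutoff R x := by
  rcases le_total ‖x‖ R with h | h
  · rw [cutoff_eq_one (by linarith) h]
    exact cutoff_le_one _ _
  · rw [cutoff_eq_zero hr (by linarith)]
    exact cutoff_nonneg _ _

theorem partialDeriv_cutoff (R : ℝ) (i : Fin 2) :
    partialDeriv i (cutoff R) = fun x => R⁻¹ • partialDeriv i planeBump (R⁻¹ • x) :=
  partialDeriv_comp_smul i _ _

theorem partialDeriv_cutoff_eq_zero {R : ℝ} (i : Fin 2) {x : Plane} (hx : ‖x‖ < R) :
    partialDeriv i (cutoff R) x = 0 := by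
  have : cutoff R =ᶠ[𝓝 x] fun _ => (1 : ℝ) := by
    filter_upwards [(isOpen_lt continuous_norm continuous_const).mem_nhds hx] with y hy
    exact cutoff_eq_one ((norm_nonneg _).trans_lt hy) (le_of_lt hy)
  simp [partialDeriv, this.fderiv_eq]

theorem coordLaplacian_cutoff (R : ℝ) (x : Plane) :
    coordLaplacian (cutoff R) x = (R ^ 2)⁻¹ * coordLaplacian planeBump (R⁻¹ • x) := by
  simp only [coordLaplacian, Finset.mul_sum, partialDeriv_cutoff]
  refine Finset.sum_congr rfl fun i _ => ?_
  rw [partialDeriv_const_smul, partialDeriv_comp_smul]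
  simp only [smul_eq_mul]
  ring

/-- This is where dimension two enters: the factor `R⁻²` from the squared derivative cancels the
Jacobian `R²`. -/
theorem integral_partialDeriv_cutoff_sq {R : ℝ} (hR : 0 < R) (i : Fin 2) :
    ∫ x, partialDeriv i (cutoff R) x ^ 2 = ∫ x, partialDeriv i planeBump x ^ 2 := by
  simp only [partialDeriv_cutoff, smul_eq_mul, mul_pow]
  rw [integral_const_mul,
    Measure.integral_comp_inv_smul_of_nonneg volume (fun x => partialDeriv i planeBump x ^ 2) hR.le]
  simp only [finrank_euclideanSpace, Fintype.card_fin, smul_eq_mul]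
  field_simp

/-- A subharmonic function is harmonic if its Laplacian, tested against large cutoffs, is
arbitrarily small. -/
theorem coordLaplacian_eq_zero_of_integral_cutoff_le {v : Plane → ℝ} (hv : ContDiff ℝ 2 v)
    (h0 : ∀ x, 0 ≤ coordLaplacian v x)
    (hlim : ∀ ε > 0, ∀ᶠ R : ℝ in atTop, ∫ x, cutoff R x * coordLaplacian v x ≤ ε) (x : Plane) :
    coordLaplacian v x = 0 := by
  by_contra hx
  set r : ℝ := ‖x‖ + 1
  have hr : 0 < r := by positivity
  have hint : ∀ R : ℝ, 0 < R → Integrable fun y => cutoff R y * coordLaplacian v y := fun R hR =>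
    ((contDiff_cutoff R).continuous.mul
      hv.continuous_coordLaplacian).integrable_of_hasCompactSupport
        (hasCompactSupport_cutoff hR).mul_right
  have hpos : 0 < ∫ y, cutoff r y * coordLaplacian v y := by
    refine Continuous.integral_pos_of_hasCompactSupport_nonneg_nonzero (x := x)
      ((contDiff_cutoff r).continuous.mul hv.continuous_coordLaplacian)
      (hasCompactSupport_cutoff hr).mul_right
      (fun y => mul_nonneg (cutoff_nonneg _ _) (h0 y)) ?_
    rw [cutoff_eq_one hr (by simp [r]), one_mul]
    exact hx
  -- From radius `2r` on, the larger cutoff is `1` on the support of the one of radius `r`, so the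
  -- positive mass persists.
  obtain ⟨R, h1, h2⟩ := ((hlim _ (half_pos hpos)).and (eventually_ge_atTop (2 * r))).exists
  have : ∫ y, cutoff r y * coordLaplacian v y ≤ ∫ y, cutoff R y * coordLaplacian v y :=
    integral_mono (hint r hr) (hint R (by linarith))
      fun y => mul_le_mul_of_nonneg_right (cutoff_le_cutoff hr h2 y) (h0 y)
  linarith

/-- An integrable subharmonic function on the plane is harmonic. -/
theorem coordLaplacian_eq_zero_of_integrable {v : Plane → ℝ} (hv : ContDiff ℝ 2 v)
    (h0 : ∀ x, 0 ≤ coordLaplacian v x) (hint : Integrable v) (x : Plane) :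
    coordLaplacian v x = 0 := by
  refine coordLaplacian_eq_zero_of_integral_cutoff_le hv h0 (fun ε hε => ?_) x
  have hb2 : ContDiff ℝ 2 planeBump := planeBump.contDiff
  have hcomp : HasCompactSupport (coordLaplacian planeBump) := by
    have : ∀ i, HasCompactSupport (partialDeriv i (partialDeriv i planeBump)) := fun i =>
      (planeBump.hasCompactSupport.partialDeriv i).partialDeriv i
    have h2 : coordLaplacian planeBump = partialDeriv 0 (partialDeriv 0 planeBump) +
        partialDeriv 1 (partialDeriv 1 planeBump) := by
      ext y
      simp [coordLaplacian, Fin.sum_univ_two]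
    rw [h2]
    exact (this 0).add (this 1)
  obtain ⟨C, hC⟩ := hcomp.exists_bound_of_continuous hb2.continuous_coordLaplacian
  -- With both derivatives moved onto the cutoff, scaling leaves the factor `R⁻²` against the `L¹`
  -- norm of `v`.
  have hlim : Tendsto (fun R : ℝ => (R ^ 2)⁻¹ * ∫ y, C * ‖v y‖) atTop (𝓝 0) := by
    have := (tendsto_inv_atTop_zero.comp (tendsto_pow_atTop (α := ℝ) two_ne_zero)).mul_const
      (∫ y, C * ‖v y‖)
    simpa using this
  filter_upwards [hlim.eventually_le_const hε, eventually_gt_atTop 0] with R hR hR0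
  rw [integral_mul_coordLaplacian_eq (contDiff_cutoff R) hv (hasCompactSupport_cutoff hR0)]
  refine le_trans ?_ hR
  rw [← integral_const_mul]
  refine (Real.le_norm_self _).trans (norm_integral_le_of_norm_le
    ((hint.norm.const_mul C).const_mul _) (ae_of_all _ fun y => ?_))
  rw [coordLaplacian_cutoff, norm_mul, norm_mul, Real.norm_of_nonneg (by positivity), mul_assoc]
  gcongr
  exact hC _

/-- A subharmonic function of finite Dirichlet energy on the plane is harmonic. -/
theorem coordLaplacian_eq_zero_of_integrable_sq {v : Plane → ℝ} (hv : ContDiff ℝ 2 v)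
    (h0 : ∀ x, 0 ≤ coordLaplacian v x)
    (hint : ∀ i, Integrable fun x => partialDeriv i v x ^ 2) (x : Plane) :
    coordLaplacian v x = 0 := by
  refine coordLaplacian_eq_zero_of_integral_cutoff_le hv h0 (fun ε hε => ?_) x
  have key : ∀ i : Fin 2, ∀ᶠ R : ℝ in atTop,
      -∫ y, partialDeriv i (cutoff R) y * partialDeriv i v y ≤ ε / 2 := by
    intro i
    set A := ∫ y, partialDeriv i planeBump y ^ 2
    have hA : 0 ≤ A := integral_nonneg fun y => sq_nonneg _
    -- Young's inequality with weight `δ`: the cutoff energy `A` does not depend on `R`, so it costs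
    -- at most `ε / 4`. The energy of `v` is needed only outside radius `R`, where the cutoff
    -- varies, and that tail supplies the other `ε / 4`.
    obtain ⟨δ, hδ, hδA⟩ : ∃ δ > 0, δ * A ≤ ε / 4 := by
      refine ⟨ε / 4 / (A + 1), by positivity, ?_⟩
      rw [div_mul_eq_mul_div, div_le_iff₀ (by positivity)]
      nlinarith
    set T : ℝ → Plane → ℝ := fun R => {y : Plane | R ≤ ‖y‖}.indicator
      fun y => (4 * δ)⁻¹ * partialDeriv i v y ^ 2
    have hmeas : ∀ R : ℝ, MeasurableSet {y : Plane | R ≤ ‖y‖} := fun R =>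
      (isClosed_le continuous_const continuous_norm).measurableSet
    have hTint : ∀ R, Integrable (T R) := fun R => ((hint i).const_mul _).indicator (hmeas R)
    have htail : Tendsto (fun R => ∫ y, T R y) atTop (𝓝 0) := by
      have := tendsto_integral_filter_of_dominated_convergence (μ := volume) (l := atTop)
        (F := T) (f := fun _ => 0)
        (fun y => (4 * δ)⁻¹ * partialDeriv i v y ^ 2)
        (Eventually.of_forall fun R => (hTint R).aestronglyMeasurable)
        (Eventually.of_forall fun R => ae_of_all _ fun y => by
          refine (norm_indicator_le_norm_self _ _).trans ?_
          rw [Real.norm_of_nonneg (by positivity)])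
        ((hint i).const_mul _)
        (ae_of_all _ fun y => by
          refine tendsto_const_nhds.congr' ?_
          filter_upwards [eventually_gt_atTop ‖y‖] with R hR
          exact (Set.indicator_of_notMem (by simpa using hR) _).symm)
      simpa using this
    filter_upwards [htail.eventually_le_const (show 0 < ε / 4 by positivity),
      eventually_gt_atTop 0] with R hR hR0
    have hc1 := ((contDiff_cutoff R).of_le one_le_two).continuous_partialDeriv i
    have hv1 := (hv.of_le one_le_two).continuous_partialDeriv i
    have hcs := (hasCompactSupport_cutoff hR0).partialDeriv i
    have hi1 : Integrable fun y => partialDeriv i (cutoff R) y * partialDeriv i v y :=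
      (hc1.mul hv1).integrable_of_hasCompactSupport hcs.mul_right
    have hi2 : Integrable fun y => δ * partialDeriv i (cutoff R) y ^ 2 := by
      refine Integrable.const_mul ?_ _
      simp only [sq]
      exact (hc1.mul hc1).integrable_of_hasCompactSupport hcs.mul_right
    have hle : -∫ y, partialDeriv i (cutoff R) y * partialDeriv i v y ≤
        ∫ y, (δ * partialDeriv i (cutoff R) y ^ 2 + T R y) := by
      rw [← integral_neg]
      refine integral_mono hi1.neg (hi2.add (hTint R)) fun y => ?_
      by_cases hy : R ≤ ‖y‖
      · have hT : T R y = (4 * δ)⁻¹ * partialDeriv i v y ^ 2 :=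
          Set.indicator_of_mem (s := {y : Plane | R ≤ ‖y‖}) hy _
        simp only [hT]
        set a := partialDeriv i (cutoff R) y
        set b := partialDeriv i v y
        have : δ * a ^ 2 + (4 * δ)⁻¹ * b ^ 2 + a * b = (2 * δ * a + b) ^ 2 * (4 * δ)⁻¹ := by
          field_simp
          ring
        have h3 : 0 ≤ (2 * δ * a + b) ^ 2 * (4 * δ)⁻¹ := by positivity
        linarith
      · have hT : T R y = 0 := Set.indicator_of_notMem (s := {y : Plane | R ≤ ‖y‖}) hy _
        simp [hT, partialDeriv_cutoff_eq_zero i (not_le.1 hy)]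
    rw [integral_add hi2 (hTint R), integral_const_mul, integral_partialDeriv_cutoff_sq hR0] at hle
    linarith
  filter_upwards [key 0, key 1, eventually_gt_atTop 0] with R h0 h1 hR0
  rw [integral_mul_coordLaplacian ((contDiff_cutoff R).of_le one_le_two) hv
    (hasCompactSupport_cutoff hR0), Fin.sum_univ_two]
  linarith

end Liouville

/-! ### A smooth convex truncation -/

section Ramp

/-- A smooth convex function vanishing on `(-∞, 0]`, positive on `(0, ∞)` and of slope at
most `1`. -/
noncomputable def ramp (t : ℝ) : ℝ := ∫ s in (0 : ℝ)..t, Real.smoothTransition s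

theorem hasDerivAt_ramp (t : ℝ) : HasDerivAt ramp (Real.smoothTransition t) t :=
  intervalIntegral.integral_hasDerivAt_right
    (Real.smoothTransition.continuous.intervalIntegrable _ _)
    (Real.smoothTransition.continuous.stronglyMeasurableAtFilter _ _)
    Real.smoothTransition.continuousAt

theorem contDiff_ramp : ContDiff ℝ 2 ramp := by
  rw [show (2 : WithTop ℕ∞) = 1 + 1 by norm_num, contDiff_succ_iff_deriv]
  refine ⟨fun t => (hasDerivAt_ramp t).differentiableAt, by simp, ?_⟩
  rw [show deriv ramp = Real.smoothTransition from funext fun t => (hasDerivAt_ramp t).deriv]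
  exact_mod_cast Real.smoothTransition.contDiff (n := 1)

theorem ramp_of_nonpos {t : ℝ} (ht : t ≤ 0) : ramp t = 0 := by
  rw [ramp, intervalIntegral.integral_congr (g := fun _ => (0 : ℝ)), intervalIntegral.integral_zero]
  intro s hs
  rw [Set.uIcc_of_ge ht] at hs
  exact Real.smoothTransition.zero_of_nonpos hs.2

theorem ramp_nonneg (t : ℝ) : 0 ≤ ramp t := by
  rcases le_total t 0 with h | h
  · rw [ramp_of_nonpos h]
  · exact intervalIntegral.integral_nonneg h fun s _ => Real.smoothTransition.nonneg s

theorem ramp_le {t : ℝ} (ht : 0 ≤ t) : ramp t ≤ t := by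
  have := intervalIntegral.integral_mono_on ht
    (Real.smoothTransition.continuous.intervalIntegrable (μ := volume) 0 t)
    (continuous_const.intervalIntegrable (μ := volume) (u := fun _ : ℝ => (1 : ℝ)) 0 t)
    fun s _ => Real.smoothTransition.le_one s
  simpa [ramp] using this

end Ramp

/-! ### Product and chain rules -/

section ScalarComposition

variable {p : Plane → ℝ} {h : ℝ → ℝ} {i : Fin 2} {x : Plane}

theorem partialDeriv_comp (hh : DifferentiableAt ℝ h (p x)) (hp : DifferentiableAt ℝ p x) :
    partialDeriv i (fun y => h (p y)) x = deriv h (p x) * partialDeriv i p x := by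
  have := (hh.hasDerivAt.comp_hasFDerivAt x hp.hasFDerivAt).fderiv
  change fderiv ℝ (h ∘ p) x _ = _
  rw [this]
  rfl

theorem partialDeriv_mul {f g : Plane → ℝ} (hf : DifferentiableAt ℝ f x)
    (hg : DifferentiableAt ℝ g x) :
    partialDeriv i (fun y => f y * g y) x =
      f x * partialDeriv i g x + g x * partialDeriv i f x := by
  simp [partialDeriv, fderiv_fun_mul hf hg]

theorem partialDeriv_inner {f g : Plane → Plane} (hf : DifferentiableAt ℝ f x)
    (hg : DifferentiableAt ℝ g x) :
    partialDeriv i (fun y => inner ℝ (f y) (g y)) x =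
      inner ℝ (f x) (partialDeriv i g x) + inner ℝ (partialDeriv i f x) (g x) := by
  simp [partialDeriv, fderiv_inner_apply ℝ hf hg]

theorem coordLaplacian_comp (hh : ContDiff ℝ 2 h) (hp : ContDiff ℝ 2 p) (x : Plane) :
    coordLaplacian (fun y => h (p y)) x =
      deriv (deriv h) (p x) * ∑ i : Fin 2, partialDeriv i p x ^ 2 +
        deriv h (p x) * coordLaplacian p x := by
  have hd : Differentiable ℝ h := hh.differentiable two_ne_zero
  have hpd : Differentiable ℝ p := hp.differentiable two_ne_zero
  have hh2 : ContDiff ℝ 1 (deriv h) := by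
    rw [show (2 : WithTop ℕ∞) = 1 + 1 by norm_num, contDiff_succ_iff_deriv] at hh
    exact hh.2.2
  simp only [coordLaplacian, Finset.mul_sum, ← Finset.sum_add_distrib]
  refine Finset.sum_congr rfl fun i _ => ?_
  have h1 : partialDeriv i (fun y => h (p y)) = fun y => deriv h (p y) * partialDeriv i p y :=
    funext fun y => partialDeriv_comp (hd _) (hpd _)
  have h2 : DifferentiableAt ℝ (deriv h) (p x) := hh2.differentiable one_ne_zero _
  rw [h1, partialDeriv_mul (f := fun y => deriv h (p y)) (h2.comp x (hpd x))
    ((hp.partialDeriv_one i).differentiable one_ne_zero x), partialDeriv_comp h2 (hpd x)]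
  ring

end ScalarComposition

/-! ### The regularized modulus -/

section RegularizedModulus

/-- The smooth modulus `√(1 + |u|²)`. -/
noncomputable def japaneseModulus (u : Plane → Plane) (x : Plane) : ℝ := √(1 + ‖u x‖ ^ 2)

variable {u : Plane → Plane}

theorem japaneseModulus_sq (u : Plane → Plane) (x : Plane) :
    japaneseModulus u x ^ 2 = 1 + ‖u x‖ ^ 2 :=
  Real.sq_sqrt (by positivity)

theorem japaneseModulus_pos (u : Plane → Plane) (x : Plane) : 0 < japaneseModulus u x :=
  Real.sqrt_pos.2 (by positivity)

theorem contDiff_japaneseModulus (hu : ContDiff ℝ 2 u) : ContDiff ℝ 2 (japaneseModulus u) :=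
  (contDiff_const.add (hu.norm_sq ℝ)).sqrt fun x => by positivity

theorem japaneseModulus_mul_partialDeriv (hu : ContDiff ℝ 2 u) (i : Fin 2) (x : Plane) :
    japaneseModulus u x * partialDeriv i (japaneseModulus u) x =
      inner ℝ (u x) (partialDeriv i u x) := by
  have hpd := (contDiff_japaneseModulus hu).differentiable two_ne_zero x
  have hud := hu.differentiable two_ne_zero x
  have h1 := partialDeriv_mul (i := i) hpd hpd
  have h2 := partialDeriv_inner (i := i) hud hud
  have h3 : (fun y => japaneseModulus u y * japaneseModulus u y) =
      fun y => 1 + inner ℝ (u y) (u y) := by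
    ext y
    rw [← sq, japaneseModulus_sq, real_inner_self_eq_norm_sq]
  have h4 : partialDeriv i (fun y => 1 + inner ℝ (u y) (u y)) x =
      partialDeriv i (fun y => inner ℝ (u y) (u y)) x := by
    simp [partialDeriv, fderiv_const_add]
  rw [h3, h4, h2, real_inner_comm (u x)] at h1
  linarith

/-- Cauchy–Schwarz in `p ∂ᵢp = u · ∂ᵢu`, together with `|u| ≤ p`. -/
theorem partialDeriv_japaneseModulus_sq_le (hu : ContDiff ℝ 2 u) (i : Fin 2) (x : Plane) :
    partialDeriv i (japaneseModulus u) x ^ 2 ≤ ‖partialDeriv i u x‖ ^ 2 := by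
  have h1 := japaneseModulus_mul_partialDeriv hu i x
  have h2 := abs_real_inner_le_norm (u x) (partialDeriv i u x)
  have h3 := japaneseModulus_sq u x
  have h4 : japaneseModulus u x ^ 2 * partialDeriv i (japaneseModulus u) x ^ 2 ≤
      japaneseModulus u x ^ 2 * ‖partialDeriv i u x‖ ^ 2 := by
    rw [← mul_pow, h1, ← sq_abs, h3]
    calc |inner ℝ (u x) (partialDeriv i u x)| ^ 2 ≤ (‖u x‖ * ‖partialDeriv i u x‖) ^ 2 := by
          gcongr
      _ ≤ (1 + ‖u x‖ ^ 2) * ‖partialDeriv i u x‖ ^ 2 := by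
          rw [mul_pow]
          gcongr
          linarith
  exact le_of_mul_le_mul_left h4 (pow_pos (japaneseModulus_pos u x) 2)

/-- Differentiating `p ∂ᵢp = u · ∂ᵢu` once more leaves the surplus `|∂ᵢu|² - (∂ᵢp)²`, which is
nonnegative. -/
theorem inner_coordLaplacian_le (hu : ContDiff ℝ 2 u) (x : Plane) :
    inner ℝ (u x) (coordLaplacian u x) ≤
      japaneseModulus u x * coordLaplacian (japaneseModulus u) x := by
  have hp := contDiff_japaneseModulus hu
  simp only [coordLaplacian, inner_sum, Finset.mul_sum]
  refine Finset.sum_le_sum fun i _ => ?_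
  have hpd := hp.differentiable two_ne_zero x
  have hud := hu.differentiable two_ne_zero x
  have h1 := partialDeriv_mul (i := i) hpd
    ((hp.partialDeriv_one i).differentiable one_ne_zero x)
  have h2 := partialDeriv_inner (i := i) hud
    ((hu.partialDeriv_one i).differentiable one_ne_zero x)
  rw [funext (japaneseModulus_mul_partialDeriv hu i), h2, real_inner_self_eq_norm_sq] at h1
  have h3 := partialDeriv_japaneseModulus_sq_le hu i x
  nlinarith

end RegularizedModulus

/-! ### Lower bounds on the potential -/

theorem strictAntiOn_Iic_of_deriv_neg {J : ℝ → ℝ} (hJ : ContDiff ℝ 2 J)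
    (hJ_neg : ∀ t : ℝ, t < 0 → deriv J t < 0) : StrictAntiOn J (Set.Iic 0) :=
  strictAntiOn_of_deriv_neg (convex_Iic 0) hJ.continuous.continuousOn (by simpa using hJ_neg)

/-- Under the growth condition at `-∞`, `√(1 + s)` is controlled by `J (1 - s)` for `s` bounded
away from `1`. -/
theorem exists_sqrt_le_mul {J : ℝ → ℝ} (hJ : ContDiff ℝ 2 J) (hJ_nonneg : ∀ t : ℝ, 0 ≤ J t)
    (hJ_growth : ∃ K : ℝ, 0 < K ∧
      (K : EReal) < Filter.liminf (fun t : ℝ => ((J t / √|t| : ℝ) : EReal)) Filter.atBot)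
    (hJ_neg : ∀ t : ℝ, t < 0 → deriv J t < 0) {ε : ℝ} (hε : 0 < ε) :
    ∃ C : ℝ, 0 ≤ C ∧ ∀ s : ℝ, 1 + ε ≤ s → √(1 + s) ≤ C * J (1 - s) := by
  have hanti := strictAntiOn_Iic_of_deriv_neg hJ hJ_neg
  obtain ⟨K, hK, hlim⟩ := hJ_growth
  obtain ⟨T, hT⟩ := eventually_atBot.1 (eventually_lt_of_lt_liminf hlim)
  -- The cap `-1` gives `s ≥ 2` when `1 - s ≤ S`, hence `1 + s ≤ 4 (s - 1)`.
  set S := min T (-1)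
  have hJε : 0 < J (-ε) := (hJ_nonneg _).trans_lt
    (hanti (Set.mem_Iic.2 (by linarith)) (Set.mem_Iic.2 (by linarith)) 
      (by linarith : -ε < -ε / 2))
  -- The first constant serves `1 - s ≤ S`, by growth; the second serves `S ≤ 1 - s ≤ -ε`, by
  -- monotonicity of `J`.
  refine ⟨max (2 / K) (√(2 - S) / J (-ε)), le_max_of_le_left (by positivity), fun s hs => ?_⟩
  rcases le_total (1 - s) S with h | h
  · have hs1 : 1 - s ≤ -1 := h.trans (min_le_right _ _)
    have hlt := hT _ (h.trans (min_le_left _ _))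
    rw [EReal.coe_lt_coe_iff, abs_of_neg (by linarith), neg_sub,
      lt_div_iff₀ (Real.sqrt_pos.2 (by linarith))] at hlt
    have h4 : √(1 + s) ≤ 2 * √(s - 1) := by
      rw [Real.sqrt_le_left (by positivity), mul_pow, Real.sq_sqrt (by linarith)]
      linarith
    calc √(1 + s) ≤ 2 / K * (K * √(s - 1)) := by
          rw [← mul_assoc, div_mul_cancel₀ _ hK.ne']
          exact h4
      _ ≤ 2 / K * J (1 - s) := by gcongr
      _ ≤ _ := mul_le_mul_of_nonneg_right (le_max_left _ _) (hJ_nonneg _)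
  · have hJs : J (-ε) ≤ J (1 - s) :=
      hanti.antitoneOn (Set.mem_Iic.2 (by linarith)) (Set.mem_Iic.2 (by linarith)) (by linarith)
    calc √(1 + s) ≤ √(2 - S) := Real.sqrt_le_sqrt (by linarith)
      _ = √(2 - S) / J (-ε) * J (-ε) := (div_mul_cancel₀ _ hJε.ne').symm
      _ ≤ √(2 - S) / J (-ε) * J (1 - s) := by gcongr
      _ ≤ _ := mul_le_mul_of_nonneg_right (le_max_right _ _) (hJ_nonneg _)

theorem integrable_of_lintegral_ofReal_lt_top {f : Plane → ℝ} (hf : Continuous f)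
    (h0 : ∀ x, 0 ≤ f x) (hfin : (∫⁻ x, ENNReal.ofReal (f x)) < ⊤) : Integrable f :=
  (lintegral_ofReal_ne_top_iff_integrable hf.aestronglyMeasurable (ae_of_all _ h0)).1 hfin.ne

/-! ### The bound on the modulus -/

theorem proposition2p1
    (J : ℝ → ℝ) (hJ : ContDiff ℝ 2 J) (hJ_nonneg : ∀ t : ℝ, 0 ≤ J t)
    (hJ_zero : J 0 = 0) (hJ_pos : ∀ t : ℝ, 0 < t → 0 < J t)
    (hJ_growth : ∃ K : ℝ, 0 < K ∧
      (K : EReal) < Filter.liminf (fun t : ℝ => ((J t / √|t| : ℝ) : EReal)) Filter.atBot)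
    (hJ_neg : ∀ t : ℝ, t < 0 → deriv J t < 0)
    (u : Plane → Plane) (hu : IsClassicalSolution J u)
    (hfin : (∫⁻ x : Plane, ENNReal.ofReal (gradSq u x)) < ⊤ ∨
      (∫⁻ x : Plane, ENNReal.ofReal (J (1 - ‖u x‖ ^ 2))) < ⊤) :
    ∀ x : Plane, ‖u x‖ ≤ 1 := by
  obtain ⟨hu2, heq⟩ := hu
  intro x₀
  suffices h : ∀ ε > 0, ‖u x₀‖ ^ 2 ≤ 1 + ε by
    have h1 : ‖u x₀‖ ^ 2 ≤ 1 := le_of_forall_pos_le_add h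
    exact (sq_le_one_iff₀ (norm_nonneg _)).1 h1
  intro ε hε
  by_contra! hx₀
  set p := japaneseModulus u
  -- The value of `p` at `|u|² = 1 + ε`.
  set a := √(2 + ε)
  have hp : ContDiff ℝ 2 p := contDiff_japaneseModulus hu2
  have hpd : Differentiable ℝ p := hp.differentiable two_ne_zero
  have ha : ∀ x, a < p x → 1 + ε < ‖u x‖ ^ 2 := fun x hx => by
    have := (Real.sqrt_lt_sqrt_iff (by linarith)).1 hx
    linarith
  set h : ℝ → ℝ := fun t => ramp (t - a)
  have hh : ContDiff ℝ 2 h := contDiff_ramp.comp (contDiff_id.sub contDiff_const)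
  have hh1 : deriv h = fun t => Real.smoothTransition (t - a) :=
    funext fun t => ((hasDerivAt_ramp (t - a)).comp_sub_const t a).deriv
  have hh2 : ∀ t, 0 ≤ deriv (deriv h) t := fun t => by
    rw [hh1]
    exact (Real.smoothTransition.monotone.comp fun _ _ hst => sub_le_sub_right hst a).deriv_nonneg
  have hΔp : ∀ x, a < p x → 0 < coordLaplacian p x := fun x hx => by
    have h1 := inner_coordLaplacian_le hu2 x
    have h2 : coordLaplacian u x = -(deriv J (1 - ‖u x‖ ^ 2) • u x) := by
      rw [← heq x, neg_neg, laplacian_eq_coordLaplacian hu2]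
    rw [h2, inner_neg_right, inner_smul_right, real_inner_self_eq_norm_sq] at h1
    have h3 := ha x hx
    have h4 := hJ_neg (1 - ‖u x‖ ^ 2) (by linarith)
    have h5 : 0 < japaneseModulus u x * coordLaplacian (japaneseModulus u) x := by nlinarith
    exact pos_of_mul_pos_right h5 (japaneseModulus_pos u x).le
  set v : Plane → ℝ := fun x => h (p x)
  have hv : ContDiff ℝ 2 v := hh.comp hp
  have hΔv : ∀ x, deriv h (p x) * coordLaplacian p x ≤ coordLaplacian v x := fun x => by
    rw [coordLaplacian_comp hh hp]
    exact le_add_of_nonneg_left (mul_nonneg (hh2 _) (Finset.sum_nonneg fun i _ => sq_nonneg _))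
  have hΔv0 : ∀ x, 0 ≤ coordLaplacian v x := fun x => by
    refine le_trans ?_ (hΔv x)
    rw [hh1]
    rcases le_or_gt (p x) a with hx | hx
    · simp [Real.smoothTransition.zero_of_nonpos (sub_nonpos.2 hx)]
    · exact mul_nonneg (Real.smoothTransition.nonneg _) (hΔp x hx).le
  have hharm : ∀ x, coordLaplacian v x = 0 := by
    rcases hfin with hfin | hfin
    · have hu1 : ContDiff ℝ 1 u := hu2.of_le one_le_two
      have hgrad : Integrable (gradSq u) := integrable_of_lintegral_ofReal_lt_top
        (continuous_finsetSum _ fun i _ => (hu1.continuous_partialDeriv i).norm.pow 2)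
        (fun x => Finset.sum_nonneg fun i _ => sq_nonneg _) hfin
      refine coordLaplacian_eq_zero_of_integrable_sq hv hΔv0 fun i => hgrad.mono'
        (((hv.of_le one_le_two).continuous_partialDeriv i).pow 2).aestronglyMeasurable
        (ae_of_all _ fun x => ?_)
      rw [Real.norm_of_nonneg (sq_nonneg _),
        partialDeriv_comp (hh.differentiable two_ne_zero _) (hpd x), hh1, mul_pow]
      calc _ ≤ 1 * partialDeriv i p x ^ 2 := by
            gcongr
            exact pow_le_one₀ (Real.smoothTransition.nonneg _) (Real.smoothTransition.le_one _)
        _ ≤ ‖partialDeriv i u x‖ ^ 2 := by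
            rw [one_mul]
            exact partialDeriv_japaneseModulus_sq_le hu2 i x
        _ ≤ gradSq u x := Finset.single_le_sum (f := fun i => ‖partialDeriv i u x‖ ^ 2)
            (fun i _ => sq_nonneg _) (Finset.mem_univ i)
    · obtain ⟨C, hC0, hC⟩ := exists_sqrt_le_mul hJ hJ_nonneg hJ_growth hJ_neg hε
      have hpot : Integrable fun x => J (1 - ‖u x‖ ^ 2) := integrable_of_lintegral_ofReal_lt_top
        (hJ.continuous.comp (continuous_const.sub (hu2.continuous.norm.pow 2)))
        (fun x => hJ_nonneg _) hfin
      refine coordLaplacian_eq_zero_of_integrable hv hΔv0 ((hpot.const_mul C).mono'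
        hv.continuous.aestronglyMeasurable (ae_of_all _ fun x => ?_))
      rw [Real.norm_of_nonneg (ramp_nonneg _)]
      rcases le_or_gt (p x) a with hx | hx
      · exact (ramp_of_nonpos (sub_nonpos.2 hx)).trans_le (mul_nonneg hC0 (hJ_nonneg _))
      · exact ((ramp_le (sub_nonneg.2 hx.le)).trans (sub_le_self _ (Real.sqrt_nonneg _))).trans
          (hC _ (ha x hx).le)
  have hpx₀ : a < p x₀ := Real.sqrt_lt_sqrt (by linarith) (by linarith)
  have hpos : 0 < deriv h (p x₀) * coordLaplacian p x₀ := by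
    rw [hh1]
    exact mul_pos (Real.smoothTransition.pos_of_pos (sub_pos.2 hpx₀)) (hΔp x₀ hpx₀)
  exact (hpos.trans_le (hΔv x₀)).ne' (hharm x₀)
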